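/- Let $E$ be a finite set, and let $(E,\mathcal P)$ be an abstract network: $\mathcal P$ is a family of nonempty subsets of $E$ (paths), each $P\in\mathcal P$ carries a strict linear order $<_P$, and whenever $P,Q\in\mathcal P$ and $e\in P\cap Q$ there is $R\in\mathcal P$ with $R\subseteq\{p\in P: p\le_P e\}\cup\{q\in Q: q\ge_Q e\}$. Let $c\in\mathbb R_{\ge 0}^E$ be capacities, $\tau\in\mathbb Z_{\ge 0}^E$ transit times, $T\in\mathbb Z_{\ge 0}$ a time horizon, $\mathcal T=\{0,\dots,T-1\}$ and $E_T=E\times\mathcal T$. For $P\in\mathcal P$ and $\sigma:P\to\mathcal T$ with $\sum_{e\in P}(\sigma(e)+\tau(e))<T$, the temporal path with waiting times $\sigma$ is $$P_\sigma=\Big\{(e,\theta)\in E_T:\ e\in P,\ \theta=\sigma(e)+\sum_{p<_Pe}(\sigma(p)+\tau(p))\Big\};$$ let $\mathcal P_T^*$ be the set of all of these. For $P\in\mathcal P$ and $t\in\mathcal T$ with $t+\sum_{e\in P}\tau(e)<T$, the temporal path that starts at time $t$ and never waits at intermediate elements is $P_t=\{(e,\theta)\in E_T: e\in P,\ \theta=t+\sum_{p<_Pe}\tau(p)\}$;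 it equals $P_{(t,0,\dots,0)}\in\mathcal P_T^*$. Let $\mathcal P_T\subseteq\mathcal P_T^*$ be the set of all of these. An abstract flow over time with waiting is a map $x:\mathcal P_T^*\to\mathbb R_{\ge0}$ with $\sum_{S\in\mathcal P_T^*:\,(e,\theta)\in S}x(S)\le c(e)$ for all $(e,\theta)\in E_T$. It is maximum if it maximizes $\sum_{S\in\mathcal P_T^*}x(S)$ among all abstract flows over time with waiting. Put $r(P)=T-\sum_{e\in P}\tau(e)$, and consider the static weighted abstract flow problem $$\max\Big\{\sum_{P\in\mathcal P}r(P)\tilde x(P):\ \tilde x\ge0,\ \sum_{P\ni e}\tilde x(P)\le c(e)\ \ \forall e\in E\Big\}$$ and its dual $$\min\Big\{\sum_{e\in E}c(e)\tilde y(e):\ \tilde y\ge0,\ \sum_{e\in P}\tilde y(e)\ge r(P)\ \ \forall P\in\mathcal P\Big\}.$$ Then the following hold. (1) There is a maximum abstract flow over time with waiting that does not wait at intermediate elements, i.e. that is zero on $\mathcal P_T^*\setminus\mathcal P_T$. (2) The static problem has an optimal solution. For every optimal solution $\tilde x$, the temporally repeated flow, given by $P_t\mapsto\tilde x(P)$ for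 $P_t\in\mathcal P_T$ and by $0$ on $\mathcal P_T^*\setminus\mathcal P_T$, is a maximum abstract flow over time with waiting. (3) The dual has an integral optimal solution. For every integral optimal solution $\tilde y$, put $\alpha(e)=\min_{P\in\mathcal P:\,e\in P}\sum_{p<_Pe}(\tau(p)+\tilde y(p))$ (with $\alpha(e)=0$ if $e$ lies on no path). Then the set $$C=\{(e,\theta)\in E_T:\ \alpha(e)\le\theta<\alpha(e)+\tilde y(e)\}$$ meets every $P_\sigma\in\mathcal P_T^*$. -/

import Mathlib

/-- An abstract network on a ground set `E`: a family of nonempty subsets of `E`, the paths, each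
carrying a strict linear order of its elements, with the switching property. The values of
`lt P a b` with `P` not a path, or `a` or `b` not in `P`, play no role. -/
structure AbstractNetwork (E : Type*) where
  /-- the paths -/
  paths : Finset (Finset E)
  /-- `lt P a b` means `a <_P b` -/
  lt : Finset E → E → E → Prop
  nonempty : ∀ P ∈ paths, P.Nonempty
  lt_irrefl : ∀ P ∈ paths, ∀ a ∈ P, ¬ lt P a a
  lt_trans : ∀ P ∈ paths, ∀ a ∈ P, ∀ b ∈ P, ∀ d ∈ P, lt P a b → lt P b d → lt P a d
  lt_total : ∀ P ∈ paths, ∀ a ∈ P, ∀ b ∈ P, lt P a b ∨ a = b ∨ lt P b a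
  switching : ∀ P ∈ paths, ∀ Q ∈ paths, ∀ e, e ∈ P → e ∈ Q →
    ∃ R ∈ paths, ∀ a ∈ R, (a ∈ P ∧ (lt P a e ∨ a = e)) ∨ (a ∈ Q ∧ (a = e ∨ lt Q e a))

namespace AbstractNetwork

noncomputable section

open scoped Classical

variable {E : Type*} [Fintype E] (N : AbstractNetwork E)

/-- The elements of `P` strictly before `e` with respect to `<_P`. -/
def before (P : Finset E) (e : E) : Finset E := P.filter fun p => N.lt P p e

/-! ### The static weighted problems -/

/-- Feasibility of a static abstract flow for the capacities `c`. -/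
def IsFlow (c : E → ℝ) (x : Finset E → ℝ) : Prop :=
  (∀ P ∈ N.paths, 0 ≤ x P) ∧ ∀ e : E, ∑ P ∈ N.paths.filter (fun P => e ∈ P), x P ≤ c e

/-- The weight `r(P) = T - ∑_{e ∈ P} τ(e)`. -/
def weight (τ : E → ℕ) (T : ℕ) (P : Finset E) : ℝ := (T : ℝ) - ∑ e ∈ P, (τ e : ℝ)

/-- `x` is an optimal solution of the maximum weighted abstract flow problem with weights `r`. -/
def IsMaxWeightedFlow (c : E → ℝ) (τ : E → ℕ) (T : ℕ) (x : Finset E → ℝ) : Prop :=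
  N.IsFlow c x ∧ ∀ x' : Finset E → ℝ, N.IsFlow c x' →
    ∑ P ∈ N.paths, weight τ T P * x' P ≤ ∑ P ∈ N.paths, weight τ T P * x P

/-- Feasibility for the minimum weighted abstract cut problem, the dual linear program. -/
def IsWeightedCut (τ : E → ℕ) (T : ℕ) (y : E → ℝ) : Prop :=
  (∀ e, 0 ≤ y e) ∧ ∀ P ∈ N.paths, weight τ T P ≤ ∑ e ∈ P, y e

/-- `y` is an optimal solution of the minimum weighted abstract cut problem. -/
def IsMinWeightedCut (c : E → ℝ) (τ : E → ℕ) (T : ℕ) (y : E → ℝ) : Prop :=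
  N.IsWeightedCut τ T y ∧ ∀ y' : E → ℝ, N.IsWeightedCut τ T y' →
    ∑ e, c e * y e ≤ ∑ e, c e * y' e

/-! ### Time expansion -/

/-- The time expanded ground set `E_T = E × {0, …, T - 1}`. -/
def timedElements (T : ℕ) : Finset (E × ℕ) := Finset.univ ×ˢ Finset.range T

/-- The temporal path `P_t`, as the set of its temporal elements. -/
def temporalPath (τ : E → ℕ) (T : ℕ) (P : Finset E) (t : ℕ) : Finset (E × ℕ) :=
  (timedElements T).filter fun a => a.1 ∈ P ∧ a.2 = t + ∑ p ∈ N.before P a.1, τ p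

/-- The set of temporal paths (without waiting at intermediate elements). -/
def temporalPaths (τ : E → ℕ) (T : ℕ) : Finset (Finset (E × ℕ)) :=
  (timedElements T).powerset.filter fun S =>
    ∃ P ∈ N.paths, ∃ t < T, t + ∑ p ∈ P, τ p < T ∧ S = N.temporalPath τ T P t

/-- The time `γ(P_σ, e)` at which flow along `P_σ` enters `e`. -/
def entryTime (τ : E → ℕ) (P : Finset E) (σ : E → ℕ) (e : E) : ℕ :=
  ∑ p ∈ N.before P e, (σ p + τ p) + σ e

/-- The temporal path with waiting `P_σ`, as the set of its temporal elements. Only the values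
of `σ` on `P` matter. -/
def waitingPath (τ : E → ℕ) (T : ℕ) (P : Finset E) (σ : E → ℕ) : Finset (E × ℕ) :=
  (timedElements T).filter fun a => a.1 ∈ P ∧ a.2 = N.entryTime τ P σ a.1

/-- The set of temporal paths with intermediate waiting. -/
def waitingPaths (τ : E → ℕ) (T : ℕ) : Finset (Finset (E × ℕ)) :=
  (timedElements T).powerset.filter fun S =>
    ∃ P ∈ N.paths, ∃ σ : E → ℕ, (∀ e ∈ P, σ e < T) ∧ ∑ e ∈ P, (σ e + τ e) < T ∧
      S = N.waitingPath τ T P σ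

/-- Feasibility of an abstract flow over time with waiting: nonnegative values on all temporal
paths with waiting, respecting the capacity of every element at every point in time. -/
def IsWaitingFlow (c : E → ℝ) (τ : E → ℕ) (T : ℕ) (x : Finset (E × ℕ) → ℝ) : Prop :=
  (∀ S ∈ N.waitingPaths τ T, 0 ≤ x S) ∧
    ∀ a ∈ timedElements (E := E) T,
      ∑ S ∈ (N.waitingPaths τ T).filter (fun S => a ∈ S), x S ≤ c a.1

/-- `x` is a maximum abstract flow over time when waiting is allowed. -/
def IsMaxWaitingFlow (c : E → ℝ) (τ : E → ℕ) (T : ℕ) (x : Finset (E × ℕ) → ℝ) : Prop :=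
  N.IsWaitingFlow c τ T x ∧ ∀ x' : Finset (E × ℕ) → ℝ, N.IsWaitingFlow c τ T x' →
    ∑ S ∈ N.waitingPaths τ T, x' S ≤ ∑ S ∈ N.waitingPaths τ T, x S

/-- `x` sends no flow along any path that waits at intermediate elements. -/
def DoesNotWait (τ : E → ℕ) (T : ℕ) (x : Finset (E × ℕ) → ℝ) : Prop :=
  ∀ S ∈ N.waitingPaths τ T, S ∉ N.temporalPaths τ T → x S = 0

/-- The temporally repeated flow of a static flow `x`: the value `x P` on every temporal path
`P_t`, and `0` otherwise. The path `P` is recovered from the set `P_t` by projecting to `E`. -/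
def temporallyRepeated (τ : E → ℕ) (T : ℕ) (x : Finset E → ℝ) (S : Finset (E × ℕ)) : ℝ :=
  if S ∈ N.temporalPaths τ T then x (S.image Prod.fst) else 0

/-- `α(e)`, the minimum over all paths `P` containing `e` of the `(τ + y)`-length of the part of
`P` strictly before `e` (and `0` if `e` lies on no path). -/
def cutEntry (τ : E → ℕ) (y : E → ℕ) (e : E) : ℕ :=
  sInf {n : ℕ | ∃ P ∈ N.paths, e ∈ P ∧ n = ∑ p ∈ N.before P e, (τ p + y p)}

/-- The set `C = {(e, θ) ∈ E_T : α(e) ≤ θ < α(e) + y(e)}`. -/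
def cutOverTime (τ : E → ℕ) (T : ℕ) (y : E → ℕ) : Finset (E × ℕ) :=
  (timedElements T).filter fun a =>
    N.cutEntry τ y a.1 ≤ a.2 ∧ a.2 < N.cutEntry τ y a.1 + y a.1

end

end AbstractNetwork

/-! Every feasible static cut `y` gives a cut over time: with `α` the `(τ + y)`-distance to an
element, block `e` during `[α e, α e + y e)`. No schedule evades it, even with waiting
(`IsWeightedCut.exists_blocking`). Otherwise take the last element `e` of the path entered after its
interval, and switch there from a shortest path to `e` onto the path. The resulting path is either
too short for a cut, or makes a later element late as well.

Hence the cost of an integral cut bounds the value of every flow with waiting. Repeating a static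
optimum `x` yields the value `∑ r(P) x(P)`, so strong duality with an integral cut
(`exists_flow_natCut_cost_le`) closes the gap.

Integrality rests on the same blocking argument in real time: sampling the blocking intervals at the
times `s + ℤ` gives an integral cut for each `s` in `[0, 1)`, and averaging over `s` recovers the
cost of `y`. -/

/-! ### Linear programming duality for packings of finite sets -/

section Packing

open scoped Classical
open Filter Topology

variable {E : Type*}

/-- The fractional packings of the members of `A` with capacities `b`. -/
def packings (A : Finset (Finset E)) (b : E → ℝ) : Set (Finset E → ℝ) :=
  {x | (∀ P, 0 ≤ x P) ∧ (∀ P ∉ A, x P = 0) ∧ ∀ e, ∑ P ∈ A.filter (fun P => e ∈ P), x P ≤ b e}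

theorem packings_le {A : Finset (Finset E)} (hA : ∀ P ∈ A, P.Nonempty) {b : E → ℝ} {M : ℝ}
    (hM : ∀ e, b e ≤ M) (hM0 : 0 ≤ M) {x : Finset E → ℝ} (hx : x ∈ packings A b) (P : Finset E) :
    x P ≤ M := by
  by_cases hP : P ∈ A
  · obtain ⟨e, he⟩ := hA P hP
    refine le_trans ?_ ((hx.2.2 e).trans (hM e))
    exact Finset.single_le_sum (f := x) (fun Q _ => hx.1 Q) (Finset.mem_filter.2 ⟨hP, he⟩)
  · rw [hx.2.1 P hP]; exact hM0

/-- Closedness is needed jointly in packing and capacities, since the capacities vary along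
sequences in `packingCone`. -/
theorem isClosed_packings_graph (A : Finset (Finset E)) :
    IsClosed {p : (Finset E → ℝ) × (E → ℝ) | p.1 ∈ packings A p.2} := by
  change IsClosed {p : (Finset E → ℝ) × (E → ℝ) | (∀ P, 0 ≤ p.1 P) ∧ (∀ P ∉ A, p.1 P = 0) ∧
    ∀ e, ∑ P ∈ A.filter (fun P => e ∈ P), p.1 P ≤ p.2 e}
  simp only [Set.ofPred_and, Set.ofPred_forall]
  refine IsClosed.inter ?_ (IsClosed.inter ?_ ?_)
  · exact isClosed_iInter fun P => isClosed_le (by fun_prop) (by fun_prop)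
  · exact isClosed_iInter fun P => isClosed_iInter fun _ =>
      isClosed_eq (by fun_prop) (by fun_prop)
  · exact isClosed_iInter fun e => isClosed_le (by fun_prop) (by fun_prop)

variable [Fintype E]

theorem isCompact_packings {A : Finset (Finset E)} (hA : ∀ P ∈ A, P.Nonempty) (b : E → ℝ) :
    IsCompact (packings A b) := by
  obtain ⟨M, hM⟩ := (Set.finite_range b).bddAbove
  have hsub : packings A b ⊆ Set.Icc 0 (fun _ => max M 0) := fun x hx =>
    ⟨fun P => hx.1 P, fun P => packings_le hA
      (fun e => (hM ⟨e, rfl⟩).trans (le_max_left _ _)) (le_max_right _ _) hx P⟩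
  refine isCompact_Icc.of_isClosed_subset ?_ hsub
  exact (isClosed_packings_graph A).preimage (f := fun x => (x, b)) (by fun_prop)

/-- The cone of all pairs of capacities and values achieved by a fractional packing. -/
def packingCone (A : Finset (Finset E)) (hA : ∀ P ∈ A, P.Nonempty) (r : Finset E → ℝ) :
    ProperCone ℝ ((E → ℝ) × ℝ) where
  carrier := {z | ∃ x ∈ packings A z.1, z.2 ≤ ∑ P ∈ A, r P * x P}
  zero_mem' := ⟨0, ⟨fun _ => le_rfl, fun _ _ => rfl, fun e => by simp⟩, by simp⟩
  add_mem' := by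
    rintro z w ⟨x, hx, hxz⟩ ⟨x', hx', hxw⟩
    refine ⟨x + x', ⟨fun P => add_nonneg (hx.1 P) (hx'.1 P), fun P hP => ?_, fun e => ?_⟩, ?_⟩
    · simp [hx.2.1 P hP, hx'.2.1 P hP]
    · simpa [Finset.sum_add_distrib] using add_le_add (hx.2.2 e) (hx'.2.2 e)
    · simpa [Finset.sum_add_distrib, mul_add] using add_le_add hxz hxw
  smul_mem' := by
    rintro ⟨a, ha⟩ z ⟨x, hx, hxz⟩
    refine ⟨a • x, ⟨fun P => mul_nonneg ha (hx.1 P), fun P hP => ?_, fun e => ?_⟩, ?_⟩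
    · simp [hx.2.1 P hP]
    · have := mul_le_mul_of_nonneg_left (hx.2.2 e) ha
      rw [Finset.mul_sum] at this
      exact this
    · have := mul_le_mul_of_nonneg_left hxz ha
      rw [Finset.mul_sum] at this
      refine this.trans (le_of_eq (Finset.sum_congr rfl fun P _ => ?_))
      exact mul_left_comm a (r P) (x P)
  isClosed' := by
    refine IsSeqClosed.isClosed fun z w hz hzw => ?_
    choose x hx hxz using hz
    -- Convergent capacities have a common bound `B`, so all witnesses lie in one compact set of
    -- packings.
    have hfst : Tendsto (fun n => (z n).1) atTop (𝓝 w.1) := hzw.fst_nhds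
    obtain ⟨B, hB⟩ : ∃ B : E → ℝ, ∀ e n, (z n).1 e ≤ B e := by
      have : ∀ e, ∃ B : ℝ, ∀ n, (z n).1 e ≤ B := fun e => by
        obtain ⟨B, hB⟩ := (tendsto_pi_nhds.1 hfst e).bddAbove_range
        exact ⟨B, fun n => hB ⟨n, rfl⟩⟩
      choose B hB using this
      exact ⟨B, hB⟩
    have hmem : ∀ n, x n ∈ packings A B := fun n =>
      ⟨(hx n).1, (hx n).2.1, fun e => ((hx n).2.2 e).trans (hB e n)⟩
    obtain ⟨x', -, φ, hφ, hlim⟩ := (isCompact_packings hA B).tendsto_subseq hmem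
    have hz' := hzw.comp hφ.tendsto_atTop
    refine ⟨x', ?_, ?_⟩
    · exact (isClosed_packings_graph A).mem_of_tendsto (hlim.prodMk_nhds hz'.fst_nhds)
        (Eventually.of_forall fun n => hx (φ n))
    · refine le_of_tendsto_of_tendsto' hz'.snd_nhds ?_ fun n => hxz (φ n)
      exact tendsto_finsetSum _ fun P _ => (tendsto_pi_nhds.1 hlim P).const_mul _

/-- Linear programming duality: an upper bound on the weight of the fractional packings is, up to
an arbitrarily small error, the cost of a fractional covering. -/
theorem exists_covering_lt {A : Finset (Finset E)} (hA : ∀ P ∈ A, P.Nonempty)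
    (r : Finset E → ℝ) {c : E → ℝ} (hc : ∀ e, 0 ≤ c e) {v : ℝ}
    (hv : ∀ x ∈ packings A c, ∑ P ∈ A, r P * x P < v) :
    ∃ y : E → ℝ, (∀ e, 0 ≤ y e) ∧ (∀ P ∈ A, r P ≤ ∑ e ∈ P, y e) ∧ ∑ e, c e * y e < v := by
  have hnot : (c, v) ∉ packingCone A hA r := by
    rintro ⟨x, hx, hxv⟩
    exact (hv x hx).not_ge hxv
  -- The functional is nonnegative on the cone and negative at `(c, v)`. Its coefficients `g`,
  -- scaled by the price `l` of one unit of value, form the covering.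
  obtain ⟨f, hf, hfc⟩ := (packingCone A hA r).hyperplane_separation_point hnot
  set g : E → ℝ := fun e => f (Pi.single e 1, 0) with hg
  set l : ℝ := - f (0, 1) with hl
  have hf_eq : ∀ (b : E → ℝ) (t : ℝ), f (b, t) = ∑ e, b e * g e - t * l := by
    intro b t
    have h1 : (b, t) = ∑ e, b e • ((Pi.single e 1, 0) : (E → ℝ) × ℝ)
        + t • ((0, 1) : (E → ℝ) × ℝ) := by
      ext i
      · simp [Prod.fst_sum, Finset.sum_apply, Pi.single_apply]
      · simp [Prod.snd_sum]
    rw [h1, map_add, map_sum]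
    simp only [map_smul, smul_eq_mul, hg, hl]
    ring
  have hzero : (0 : Finset E → ℝ) ∈ packings A 0 :=
    ⟨fun _ => le_rfl, fun _ _ => rfl, fun e => by simp⟩
  have hl0 : 0 ≤ l := by
    have := hf (0, -1) ⟨0, hzero, by simp⟩
    rw [hf_eq] at this
    simpa using this
  have hg0 : ∀ e, 0 ≤ g e := by
    intro e
    refine hf (Pi.single e 1, 0) ⟨0, ⟨fun _ => le_rfl, fun _ _ => rfl, fun e' => ?_⟩, by simp⟩
    simp only [Pi.zero_apply, Finset.sum_const_zero, Pi.single_apply]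
    split_ifs <;> norm_num
  have hP : ∀ P ∈ A, r P * l ≤ ∑ e ∈ P, g e := by
    intro P hP
    -- One unit of flow on `P` puts this pair in the cone.
    have := hf (fun e => if e ∈ P then 1 else 0, r P) ⟨Pi.single P 1, ⟨fun Q => ?_, fun Q hQ => ?_,
      fun e => ?_⟩, ?_⟩
    · rw [hf_eq] at this
      simpa [Finset.sum_ite_mem] using this
    · simp only [Pi.single_apply]; split_ifs <;> norm_num
    · have : Q ≠ P := fun h => hQ (h ▸ hP)
      simp [this]
    · simp [Pi.single_apply, hP]
    · simp [Pi.single_apply, hP]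
  rw [hf_eq] at hfc
  -- If `l` vanished, the functional at `(c, v)` would be `∑ c e * g e ≥ 0`.
  have hl1 : 0 < l := by
    refine hl0.lt_of_ne fun h => ?_
    rw [← h, mul_zero, sub_zero] at hfc
    exact hfc.not_ge (Finset.sum_nonneg fun e _ => mul_nonneg (hc e) (hg0 e))
  refine ⟨fun e => g e / l, fun e => div_nonneg (hg0 e) hl0, fun P hPA => ?_, ?_⟩
  · rw [← Finset.sum_div, le_div_iff₀ hl1]
    exact hP P hPA
  · simp only [← mul_div_assoc]
    rw [← Finset.sum_div, div_lt_iff₀ hl1]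
    linarith

end Packing

namespace AbstractNetwork

/-! ### Distances in abstract networks and the blocking argument -/

section Cuts

open scoped Classical

variable {E : Type*} (N : AbstractNetwork E)

theorem mem_before {P : Finset E} {e p : E} : p ∈ N.before P e ↔ p ∈ P ∧ N.lt P p e := by
  simp [before]

theorem before_subset (P : Finset E) (e : E) : N.before P e ⊆ P := Finset.filter_subset _ _

variable {N}

theorem before_ssubset_before {P : Finset E} (hP : P ∈ N.paths) {a b : E} (ha : a ∈ P)
    (hb : b ∈ P) (hab : N.lt P a b) : N.before P a ⊂ N.before P b := by
  refine (Finset.ssubset_iff_of_subset fun p hp => ?_).2 ⟨a, N.mem_before.2 ⟨ha, hab⟩, fun h => ?_⟩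
  · rw [mem_before] at hp ⊢
    exact ⟨hp.1, N.lt_trans P hP p hp.1 a ha b hb hp.2 hab⟩
  · exact N.lt_irrefl P hP a ha (N.mem_before.1 h).2

/-- Every nonempty set of elements of a path has a first element. -/
theorem exists_first {P S : Finset E} (hP : P ∈ N.paths) (hS : S.Nonempty) (hSP : S ⊆ P) :
    ∃ m ∈ S, ∀ a ∈ S, ¬ N.lt P a m := by
  obtain ⟨m, hm, hmin⟩ := S.exists_min_image (fun a => (N.before P a).card) hS
  refine ⟨m, hm, fun a ha hlt => ?_⟩
  exact (hmin a ha).not_gt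
    (Finset.card_lt_card (before_ssubset_before hP (hSP ha) (hSP hm) hlt))

/-- Every nonempty set of elements of a path has a last element. -/
theorem exists_last {P S : Finset E} (hP : P ∈ N.paths) (hS : S.Nonempty) (hSP : S ⊆ P) :
    ∃ m ∈ S, ∀ a ∈ S, ¬ N.lt P m a := by
  obtain ⟨m, hm, hmax⟩ := S.exists_max_image (fun a => (N.before P a).card) hS
  refine ⟨m, hm, fun a ha hlt => ?_⟩
  exact (hmax a ha).not_gt
    (Finset.card_lt_card (before_ssubset_before hP (hSP hm) (hSP ha) hlt))

theorem sum_before_add_le {P : Finset E} (hP : P ∈ N.paths) {e : E} (he : e ∈ P) {w : E → ℝ}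
    (hw : ∀ e, 0 ≤ w e) : ∑ p ∈ N.before P e, w p + w e ≤ ∑ p ∈ P, w p := by
  have hnot : e ∉ N.before P e := fun h => N.lt_irrefl P hP e he (N.mem_before.1 h).2
  rw [add_comm, ← Finset.sum_insert hnot]
  exact Finset.sum_le_sum_of_subset_of_nonneg
    (Finset.insert_subset he (N.before_subset P e)) fun p _ _ => hw p

theorem sum_before_add_le_sum_before {P : Finset E} (hP : P ∈ N.paths) {e f : E} (he : e ∈ P)
    (hf : f ∈ P) (hef : N.lt P e f) {w : E → ℝ} (hw : ∀ e, 0 ≤ w e) :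
    ∑ p ∈ N.before P e, w p + w e ≤ ∑ p ∈ N.before P f, w p := by
  have hnot : e ∉ N.before P e := fun h => N.lt_irrefl P hP e he (N.mem_before.1 h).2
  rw [add_comm, ← Finset.sum_insert hnot]
  exact Finset.sum_le_sum_of_subset_of_nonneg
    (Finset.insert_subset (N.mem_before.2 ⟨he, hef⟩) (before_ssubset_before hP he hf hef).1)
    fun p _ _ => hw p

variable (N) in
/-- `α e` is the minimal `w`-length of the part strictly before `e` of a path containing `e`. -/
def IsEntryDistance (w α : E → ℝ) : Prop :=
  ∀ e, (∀ P ∈ N.paths, e ∈ P → α e ≤ ∑ p ∈ N.before P e, w p) ∧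
    ∀ P ∈ N.paths, e ∈ P → ∃ Q ∈ N.paths, e ∈ Q ∧ α e = ∑ p ∈ N.before Q e, w p

variable (N) in
theorem exists_isEntryDistance {w : E → ℝ} : ∃ α, N.IsEntryDistance w α := by
  have : ∀ e, ∃ a : ℝ, (∀ P ∈ N.paths, e ∈ P → a ≤ ∑ p ∈ N.before P e, w p) ∧
      ∀ P ∈ N.paths, e ∈ P → ∃ Q ∈ N.paths, e ∈ Q ∧ a = ∑ p ∈ N.before Q e, w p := by
    intro e
    rcases (N.paths.filter (e ∈ ·)).eq_empty_or_nonempty with h | h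
    · have h' : ∀ P ∈ N.paths, e ∉ P := by simpa [Finset.filter_eq_empty_iff] using h
      exact ⟨0, fun P hP he => absurd he (h' P hP), fun P hP he => absurd he (h' P hP)⟩
    · obtain ⟨Q, hQ, hmin⟩ :=
        Finset.exists_min_image _ (fun P => ∑ p ∈ N.before P e, w p) h
      rw [Finset.mem_filter] at hQ
      exact ⟨_, fun P hP he => hmin P (Finset.mem_filter.2 ⟨hP, he⟩),
        fun _ _ _ => ⟨Q, hQ.1, hQ.2, rfl⟩⟩
  choose α hα using this
  exact ⟨α, hα⟩

theorem weight_le_sum_iff {τ : E → ℕ} {T : ℕ} {P : Finset E} {y : E → ℝ} :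
    weight τ T P ≤ ∑ e ∈ P, y e ↔ (T : ℝ) ≤ ∑ e ∈ P, (τ e + y e) := by
  rw [weight, Finset.sum_add_distrib, sub_le_iff_le_add']

/-- A feasible cut blocks every admissible schedule of traversing a path before time `T`. -/
theorem IsWeightedCut.exists_blocking {τ : E → ℕ} {T : ℕ} {y : E → ℝ}
    (hy : N.IsWeightedCut τ T y) {α : E → ℝ} (hα : N.IsEntryDistance (fun e => τ e + y e) α)
    {P : Finset E} (hP : P ∈ N.paths) {θ : E → ℝ} (hθ0 : ∀ e ∈ P, 0 ≤ θ e)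
    (hθ : ∀ e ∈ P, ∀ f ∈ P, N.lt P e f → θ e + τ e ≤ θ f) (hθT : ∀ e ∈ P, θ e + τ e < T) :
    ∃ e ∈ P, α e ≤ θ e ∧ θ e < α e + y e := by
  by_contra! hcon
  have hw : ∀ e, 0 ≤ (τ e : ℝ) + y e := fun e => add_nonneg (Nat.cast_nonneg _) (hy.1 e)
  -- The first element is at distance at most `0`, so evading its interval means being late; thus a
  -- last late element `e` exists.
  obtain ⟨m, hm, hmfirst⟩ := exists_first hP (N.nonempty P hP) (Finset.Subset.refl P)
  have hαm : α m ≤ 0 := by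
    refine ((hα m).1 P hP hm).trans (le_of_eq (Finset.sum_eq_zero fun p hp => ?_))
    exact absurd (N.mem_before.1 hp).2 (hmfirst p (N.mem_before.1 hp).1)
  obtain ⟨e, he, hlast⟩ := exists_last (S := P.filter fun e => α e + y e ≤ θ e) hP
    ⟨m, Finset.mem_filter.2 ⟨hm, hcon m hm (hαm.trans (hθ0 m hm))⟩⟩ (Finset.filter_subset _ _)
  obtain ⟨heP, hele⟩ := Finset.mem_filter.1 he
  obtain ⟨Q, hQ, heQ, hαe⟩ := (hα e).2 P hP heP
  obtain ⟨R, hR, hRsub⟩ := N.switching Q hQ P hP e heQ heP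
  have hnot : e ∉ N.before Q e := fun h => N.lt_irrefl Q hQ e heQ (N.mem_before.1 h).2
  have hhead : ∑ p ∈ insert e (N.before Q e), ((τ p : ℝ) + y p) ≤ θ e + τ e := by
    rw [Finset.sum_insert hnot, ← hαe]
    linarith
  -- If `R` stays within the head, its length is at most `θ e + τ e < T`, against feasibility.
  -- Otherwise its first element `f` outside the head satisfies `α f ≤ θ e + τ e ≤ θ f`, so `f` is
  -- late and comes after `e` on `P`.
  rcases (R.filter fun a => a ∉ insert e (N.before Q e)).eq_empty_or_nonempty with h | h
  · have hsub : R ⊆ insert e (N.before Q e) := by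
      intro a ha
      by_contra hna
      exact Finset.notMem_empty a (h ▸ Finset.mem_filter.2 ⟨ha, hna⟩)
    have h1 := weight_le_sum_iff.1 (hy.2 R hR)
    have h2 := Finset.sum_le_sum_of_subset_of_nonneg hsub fun p _ _ => hw p
    linarith [hθT e heP]
  · obtain ⟨f, hf, hffirst⟩ := exists_first hR h (Finset.filter_subset _ _)
    obtain ⟨hfR, hfnot⟩ := Finset.mem_filter.1 hf
    obtain ⟨hfP, hef⟩ : f ∈ P ∧ N.lt P e f := by
      rw [Finset.mem_insert, mem_before] at hfnot
      rcases hRsub f hfR with ⟨h1, h2⟩ | ⟨h1, h2⟩ <;> tauto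
    have hsub : N.before R f ⊆ insert e (N.before Q e) := by
      intro a ha
      by_contra hna
      obtain ⟨haR, haf⟩ := N.mem_before.1 ha
      exact hffirst a (Finset.mem_filter.2 ⟨haR, hna⟩) haf
    have h1 := (hα f).1 R hR hfR
    have h2 := Finset.sum_le_sum_of_subset_of_nonneg hsub fun p _ _ => hw p
    have h3 := hθ e heP f hfP hef
    have h4 := hcon f hfP (by linarith)
    exact hlast f (Finset.mem_filter.2 ⟨hfP, h4⟩) hef

end Cuts

/-! ### Rounding fractional cuts by a shift of time -/

section Rounding

open scoped Classical
open MeasureTheory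

variable {E : Type*} {N : AbstractNetwork E}

/-- Rounding a fractional cut: the number of the times `n + s` with `n` an integer at which
`e` belongs to the cut over time given by `α` and `y`. -/
noncomputable def roundedCut (α y : E → ℝ) (s : ℝ) (e : E) : ℕ :=
  (⌈α e + y e - s⌉ - ⌈α e - s⌉).toNat

theorem cast_roundedCut {α y : E → ℝ} {s : ℝ} {e : E} (hy : 0 ≤ y e) :
    (roundedCut α y s e : ℝ) = (⌈α e + y e - s⌉ : ℝ) - ⌈α e - s⌉ := by
  have h : ⌈α e - s⌉ ≤ ⌈α e + y e - s⌉ := Int.ceil_mono (by linarith)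
  have : ((roundedCut α y s e : ℤ) : ℝ) = ((⌈α e + y e - s⌉ - ⌈α e - s⌉ : ℤ) : ℝ) := by
    rw [roundedCut, Int.toNat_of_nonneg (sub_nonneg.2 h)]
  simpa using this

/-- Departures along `P` at times `s + t` without waiting are all blocked. Two departures blocked at
the same element arrive there at different times, so the sampled times on `P` number at least
`r(P)`. -/
theorem IsWeightedCut.roundedCut {τ : E → ℕ} {T : ℕ} {y : E → ℝ} (hy : N.IsWeightedCut τ T y)
    {α : E → ℝ} (hα : N.IsEntryDistance (fun e => τ e + y e) α) {s : ℝ} (hs0 : 0 ≤ s)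
    (hs1 : s < 1) : N.IsWeightedCut τ T (fun e => (roundedCut α y s e : ℝ)) := by
  refine ⟨fun e => Nat.cast_nonneg _, fun P hP => ?_⟩
  have hτ0 : ∀ e, (0 : ℝ) ≤ τ e := fun e => Nat.cast_nonneg _
  have hblock : ∀ t ∈ Finset.range (T - ∑ e ∈ P, τ e), ∃ e ∈ P,
      α e ≤ s + t + ∑ p ∈ N.before P e, (τ p : ℝ) ∧
        s + t + ∑ p ∈ N.before P e, (τ p : ℝ) < α e + y e := by
    intro t ht
    have ht' : (t : ℝ) + 1 + ∑ e ∈ P, (τ e : ℝ) ≤ T := by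
      rw [Finset.mem_range] at ht
      exact_mod_cast (by omega : t + 1 + ∑ e ∈ P, τ e ≤ T)
    refine hy.exists_blocking hα hP (θ := fun e => s + t + ∑ p ∈ N.before P e, (τ p : ℝ))
      (fun e _ => ?_) (fun e he f hf hef => ?_) (fun e he => ?_)
    · have := Finset.sum_nonneg fun p (_ : p ∈ N.before P e) => hτ0 p
      positivity
    · have := sum_before_add_le_sum_before hP he hf hef hτ0
      linarith
    · have := sum_before_add_le hP he hτ0
      linarith
  have : Nonempty E := (N.nonempty P hP).to_type
  choose! g hgP hg1 hg2 using hblock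
  have hcard : T - ∑ e ∈ P, τ e ≤ ∑ e ∈ P, AbstractNetwork.roundedCut α y s e := by
    -- Each departure maps to its blocking element and its entry time there, less the shift `s`.
    have := Finset.card_le_card_of_injOn
      (s := Finset.range (T - ∑ e ∈ P, τ e))
      (t := P.sigma fun e => Finset.Ico ⌈α e - s⌉ ⌈α e + y e - s⌉)
      (fun t => ⟨g t, t + ∑ p ∈ N.before P (g t), (τ p : ℤ)⟩) ?_ ?_
    · simpa [AbstractNetwork.roundedCut] using this
    · intro t ht
      have h1 := hg1 t ht
      have h2 := hg2 t ht
      simp only [Finset.coe_sigma, Set.mem_sigma_iff, Finset.mem_coe, Finset.mem_Ico]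
      refine ⟨hgP t ht, Int.ceil_le.2 ?_, Int.lt_ceil.2 ?_⟩
      · push_cast
        linarith
      · push_cast
        linarith
    · intro t ht t' ht' heq
      obtain ⟨h1, h2⟩ := Sigma.mk.inj_iff.1 heq
      rw [h1] at h2
      simpa using eq_of_heq h2
  have hcard' : (T : ℝ) ≤
      ∑ e ∈ P, (AbstractNetwork.roundedCut α y s e : ℝ) + ∑ e ∈ P, (τ e : ℝ) := by
    exact_mod_cast (by omega : T ≤ ∑ e ∈ P, AbstractNetwork.roundedCut α y s e + ∑ e ∈ P, τ e)
  rw [weight]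
  linarith

theorem ceil_sub_eq_floor_add {a s : ℝ} (hs : s ∈ Set.Ioo (0 : ℝ) 1) :
    (⌈a - s⌉ : ℝ) = ⌊a⌋ + (Set.Iio (Int.fract a)).indicator (fun _ => (1 : ℝ)) s := by
  have ha := Int.floor_add_fract a
  by_cases h : s < Int.fract a
  · rw [Set.indicator_of_mem (Set.mem_Iio.2 h)]
    have : ⌈a - s⌉ = ⌊a⌋ + 1 := by
      rw [Int.ceil_eq_iff]
      push_cast
      constructor <;> linarith [hs.1, Int.fract_lt_one a]
    rw [this]
    push_cast
    rfl
  · rw [Set.indicator_of_notMem (by simpa using h)]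
    have : ⌈a - s⌉ = ⌊a⌋ := by
      rw [Int.ceil_eq_iff]
      constructor <;> linarith [hs.2, Int.fract_nonneg a]
    rw [this, add_zero]

theorem integrableOn_ceil_sub (a : ℝ) :
    IntegrableOn (fun s : ℝ => (⌈a - s⌉ : ℝ)) (Set.Ioo 0 1) := by
  have h : IntegrableOn
      (fun s : ℝ => (⌊a⌋ : ℝ) + (Set.Iio (Int.fract a)).indicator (fun _ => (1 : ℝ)) s)
      (Set.Ioo 0 1) := by
    exact (integrable_const _).add ((integrable_const _).indicator measurableSet_Iio)
  exact h.congr_fun (fun s hs => (ceil_sub_eq_floor_add hs).symm) measurableSet_Ioo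

/-- The ceiling is `⌊a⌋ + 1` on a set of shifts of measure `Int.fract a`, and `⌊a⌋` otherwise. Hence
the rounded cut averages exactly to `y`. -/
theorem setIntegral_ceil_sub (a : ℝ) : ∫ s in Set.Ioo (0 : ℝ) 1, (⌈a - s⌉ : ℝ) = a := by
  rw [setIntegral_congr_fun measurableSet_Ioo (fun s hs => ceil_sub_eq_floor_add (a := a) hs),
    integral_add (by simp) ((integrable_const _).indicator measurableSet_Iio),
    setIntegral_indicator measurableSet_Iio]
  have : Set.Ioo (0 : ℝ) 1 ∩ Set.Iio (Int.fract a) = Set.Ioo 0 (Int.fract a) := by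
    ext s
    simp only [Set.mem_inter_iff, Set.mem_Ioo, Set.mem_Iio]
    have := Int.fract_lt_one a
    constructor
    · rintro ⟨⟨h1, h2⟩, h3⟩; exact ⟨h1, h3⟩
    · rintro ⟨h1, h2⟩; exact ⟨⟨h1, by linarith⟩, h2⟩
  rw [this]
  simp [Int.fract_nonneg]

variable [Fintype E]

/-- A fractional cut can be rounded to an integral cut of no larger cost. -/
theorem IsWeightedCut.exists_nat_cost_le {τ : E → ℕ} {T : ℕ} {y : E → ℝ}
    (hy : N.IsWeightedCut τ T y) (c : E → ℝ) : ∃ z : E → ℕ,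
      N.IsWeightedCut τ T (fun e => (z e : ℝ)) ∧ ∑ e, c e * (z e : ℝ) ≤ ∑ e, c e * y e := by
  obtain ⟨α, hα⟩ := N.exists_isEntryDistance (w := fun e => τ e + y e)
  have hint : ∀ e, IntegrableOn
      (fun s : ℝ => c e * ((⌈α e + y e - s⌉ : ℝ) - ⌈α e - s⌉)) (Set.Ioo 0 1) := fun e =>
    ((integrableOn_ceil_sub _).sub (integrableOn_ceil_sub _)).const_mul _
  -- Some shift costs no more than the average.
  obtain ⟨s, hs, hle⟩ := exists_le_setAverage (μ := volume) (s := Set.Ioo (0 : ℝ) 1)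
    (f := fun s => ∑ e, c e * ((⌈α e + y e - s⌉ : ℝ) - ⌈α e - s⌉)) (by simp) (by simp)
    (integrable_finsetSum _ fun e _ => hint e)
  refine ⟨AbstractNetwork.roundedCut α y s, hy.roundedCut hα hs.1.le hs.2, ?_⟩
  simp only [cast_roundedCut (hy.1 _)]
  refine hle.trans (le_of_eq ?_)
  rw [setAverage_eq, integral_finsetSum _ fun e _ => hint e]
  simp only [Real.volume_real_Ioo, sub_zero, zero_le_one, sup_of_le_left, inv_one, one_smul]
  refine Finset.sum_congr rfl fun e _ => ?_
  rw [integral_const_mul, integral_sub (integrableOn_ceil_sub _) (integrableOn_ceil_sub _),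
    setIntegral_ceil_sub, setIntegral_ceil_sub]
  ring

end Rounding

end AbstractNetwork

/-- Weak duality: the weight of a fractional packing is at most the cost of a covering. -/
theorem Finset.sum_mul_le_sum_mul_of_covering {ι : Type*} [DecidableEq ι] {A : Finset (Finset ι)}
    {U : Finset ι} (hU : ∀ S ∈ A, S ⊆ U) {x : Finset ι → ℝ} (hx : ∀ S ∈ A, 0 ≤ x S) {c y : ι → ℝ}
    (hxc : ∀ a ∈ U, ∑ S ∈ A.filter (fun S => a ∈ S), x S ≤ c a) (hy : ∀ a ∈ U, 0 ≤ y a)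
    {r : Finset ι → ℝ} (hr : ∀ S ∈ A, r S ≤ ∑ a ∈ S, y a) :
    ∑ S ∈ A, r S * x S ≤ ∑ a ∈ U, c a * y a := by
  calc ∑ S ∈ A, r S * x S ≤ ∑ S ∈ A, (∑ a ∈ S, y a) * x S :=
        Finset.sum_le_sum fun S hS => mul_le_mul_of_nonneg_right (hr S hS) (hx S hS)
    _ = ∑ S ∈ A, ∑ a ∈ U, if a ∈ S then x S * y a else 0 := by
        refine Finset.sum_congr rfl fun S hS => ?_
        rw [Finset.sum_ite_mem, Finset.inter_eq_right.2 (hU S hS), mul_comm, Finset.mul_sum]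
    _ = ∑ a ∈ U, (∑ S ∈ A.filter (fun S => a ∈ S), x S) * y a := by
        rw [Finset.sum_comm]
        refine Finset.sum_congr rfl fun a _ => ?_
        rw [← Finset.sum_filter, Finset.sum_mul]
    _ ≤ ∑ a ∈ U, c a * y a :=
        Finset.sum_le_sum fun a ha => mul_le_mul_of_nonneg_right (hxc a ha) (hy a ha)

namespace AbstractNetwork

/-! ### Static strong duality with an integral cut -/

section StaticDuality

open scoped Classical

variable {E : Type*} {N : AbstractNetwork E}

theorem isFlow_of_mem_packings {c : E → ℝ} {x : Finset E → ℝ} (hx : x ∈ packings N.paths c) :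
    N.IsFlow c x := ⟨fun P _ => hx.1 P, hx.2.2⟩

/-- In an optimal static flow, the paths of negative weight carry no flow. -/
theorem IsMaxWeightedFlow.eq_zero_of_weight_neg {c : E → ℝ} {τ : E → ℕ} {T : ℕ}
    {x : Finset E → ℝ} (hx : N.IsMaxWeightedFlow c τ T x) {P : Finset E} (hP : P ∈ N.paths)
    (hneg : weight τ T P < 0) : x P = 0 := by
  have hle : ∀ Q ∈ N.paths, Function.update x P 0 Q ≤ x Q := fun Q hQ => by
    rcases eq_or_ne Q P with rfl | h
    · simpa using hx.1.1 Q hQ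
    · simp [h]
  have hflow : N.IsFlow c (Function.update x P 0) := by
    refine ⟨fun Q hQ => ?_, fun e => le_trans (Finset.sum_le_sum fun Q hQ => ?_) (hx.1.2 e)⟩
    · rcases eq_or_ne Q P with rfl | h
      · simp
      · simpa [h] using hx.1.1 Q hQ
    · exact hle Q (Finset.mem_filter.1 hQ).1
  have h := hx.2 _ hflow
  rw [← Finset.add_sum_erase _ _ hP, ← Finset.add_sum_erase _ (fun Q => weight τ T Q * x Q) hP,
    Finset.sum_congr rfl fun Q hQ => by
      rw [Function.update_of_ne (Finset.ne_of_mem_erase hQ)]] at h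
  have h' : 0 ≤ weight τ T P * x P := by simpa using h
  exact le_antisymm (nonpos_of_mul_nonneg_right h' hneg) (hx.1.1 P hP)

theorem weight_le (τ : E → ℕ) (T : ℕ) (P : Finset E) : weight τ T P ≤ T := by
  rw [weight, sub_le_self_iff]
  exact Finset.sum_nonneg fun _ _ => Nat.cast_nonneg _

/-- Truncating an integral cut at the time horizon keeps it feasible. -/
theorem IsWeightedCut.min_horizon {τ : E → ℕ} {T : ℕ} {z : E → ℕ}
    (hz : N.IsWeightedCut τ T (fun e => (z e : ℝ))) :
    N.IsWeightedCut τ T (fun e => ((min (z e) T : ℕ) : ℝ)) := by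
  refine ⟨fun e => Nat.cast_nonneg _, fun P hP => ?_⟩
  -- A single truncated element already contributes `T`, which is at least any weight.
  by_cases h : ∃ e ∈ P, T < z e
  · obtain ⟨e, he, hlt⟩ := h
    refine (weight_le τ T P).trans ?_
    have := Finset.single_le_sum (f := fun e => ((min (z e) T : ℕ) : ℝ))
      (fun e _ => Nat.cast_nonneg _) he
    simpa only [min_eq_right hlt.le] using this
  · push Not at h
    refine (hz.2 P hP).trans (le_of_eq (Finset.sum_congr rfl fun e he => ?_))
    simp only [min_eq_left (h e he)]

variable [Fintype E]

theorem IsFlow.weight_le_cost {c : E → ℝ} {τ : E → ℕ} {T : ℕ} {x : Finset E → ℝ} {y : E → ℝ}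
    (hx : N.IsFlow c x) (hy : N.IsWeightedCut τ T y) :
    ∑ P ∈ N.paths, weight τ T P * x P ≤ ∑ e, c e * y e :=
  Finset.sum_mul_le_sum_mul_of_covering (fun _ _ => Finset.subset_univ _) hx.1
    (fun e _ => hx.2 e) (fun e _ => hy.1 e) hy.2

/-- Strong duality with an integral cut. -/
theorem exists_flow_natCut_cost_le (N : AbstractNetwork E) {c : E → ℝ} (hc : ∀ e, 0 ≤ c e)
    (τ : E → ℕ) (T : ℕ) : ∃ x, N.IsFlow c x ∧ ∃ z : E → ℕ,
      N.IsWeightedCut τ T (fun e => (z e : ℝ)) ∧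
      ∑ e, c e * (z e : ℝ) ≤ ∑ P ∈ N.paths, weight τ T P * x P := by
  obtain ⟨x, hx, hmax⟩ := (isCompact_packings N.nonempty c).exists_isMaxOn
    ⟨0, fun _ => le_rfl, fun _ _ => rfl, fun e => by simpa using hc e⟩
    (f := fun x => ∑ P ∈ N.paths, weight τ T P * x P) (by fun_prop)
  set v := ∑ P ∈ N.paths, weight τ T P * x P with hv
  have happrox : ∀ ε > 0, ∃ z : E → ℕ, (∀ e, z e ≤ T) ∧
      N.IsWeightedCut τ T (fun e => (z e : ℝ)) ∧ ∑ e, c e * (z e : ℝ) < v + ε := by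
    intro ε hε
    obtain ⟨y, hy0, hyr, hycost⟩ := exists_covering_lt N.nonempty (weight τ T) hc (v := v + ε)
      fun x' hx' => lt_of_le_of_lt (hmax hx') (by linarith)
    obtain ⟨z, hz, hzcost⟩ := IsWeightedCut.exists_nat_cost_le (N := N) ⟨hy0, hyr⟩ c
    refine ⟨fun e => min (z e) T, fun e => min_le_right _ _, hz.min_horizon, ?_⟩
    refine lt_of_le_of_lt (Finset.sum_le_sum fun e _ => ?_) (hzcost.trans_lt hycost)
    exact mul_le_mul_of_nonneg_left (Nat.cast_le.2 (min_le_left _ _)) (hc e)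
  -- Cuts bounded by `T` are finite in number, so a cheapest one exists and removes the error `ε`.
  set F := (Fintype.piFinset fun _ : E => Finset.range (T + 1)).filter
    fun z => N.IsWeightedCut τ T (fun e => (z e : ℝ)) with hF
  have hmemF : ∀ z : E → ℕ, z ∈ F ↔ (∀ e, z e ≤ T) ∧ N.IsWeightedCut τ T (fun e => (z e : ℝ)) := by
    simp [hF]
  have hne : F.Nonempty := by
    obtain ⟨z, hz1, hz2, -⟩ := happrox 1 one_pos
    exact ⟨z, (hmemF z).2 ⟨hz1, hz2⟩⟩
  obtain ⟨z, hz, hzmin⟩ := F.exists_min_image (fun z => ∑ e, c e * (z e : ℝ)) hne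
  refine ⟨x, isFlow_of_mem_packings hx, z, ((hmemF z).1 hz).2,
    le_of_forall_pos_lt_add fun ε hε => ?_⟩
  obtain ⟨z', hz1, hz2, hz3⟩ := happrox ε hε
  exact (hzmin z' ((hmemF z').2 ⟨hz1, hz2⟩)).trans_lt hz3

end StaticDuality

end AbstractNetwork

namespace AbstractNetwork

/-! ### Cuts over time and temporally repeated flows -/

section OverTime

open scoped Classical

variable {E : Type*} {N : AbstractNetwork E} {τ : E → ℕ} {T : ℕ}

theorem entryTime_add_le {P : Finset E} (hP : P ∈ N.paths) (σ : E → ℕ) {e : E} (he : e ∈ P) :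
    N.entryTime τ P σ e + τ e ≤ ∑ p ∈ P, (σ p + τ p) := by
  have := sum_before_add_le hP he (w := fun p => ((σ p + τ p : ℕ) : ℝ)) fun _ => Nat.cast_nonneg _
  rw [entryTime, add_assoc]
  exact_mod_cast this

theorem entryTime_add_le_entryTime {P : Finset E} (hP : P ∈ N.paths) (σ : E → ℕ) {e f : E}
    (he : e ∈ P) (hf : f ∈ P) (hef : N.lt P e f) :
    N.entryTime τ P σ e + τ e ≤ N.entryTime τ P σ f := by
  have := sum_before_add_le_sum_before hP he hf hef (w := fun p => ((σ p + τ p : ℕ) : ℝ))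
    fun _ => Nat.cast_nonneg _
  rw [entryTime, add_assoc]
  exact le_add_right (by exact_mod_cast this)

variable (N) in
-- The value `sInf ∅ = 0` is harmless: both conditions are vacuous at elements on no path.
theorem isEntryDistance_cutEntry (τ y : E → ℕ) :
    N.IsEntryDistance (fun e => (τ e : ℝ) + (y e : ℝ)) (fun e => (N.cutEntry τ y e : ℝ)) := by
  refine fun e => ⟨fun P hP he => ?_, fun P hP he => ?_⟩
  · beta_reduce
    exact_mod_cast Nat.sInf_le (s := {n : ℕ | ∃ P ∈ N.paths, e ∈ P ∧
      n = ∑ p ∈ N.before P e, (τ p + y p)}) ⟨P, hP, he, rfl⟩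
  · obtain ⟨Q, hQ, heQ, h⟩ := Nat.sInf_mem (s := {n : ℕ | ∃ P ∈ N.paths, e ∈ P ∧
      n = ∑ p ∈ N.before P e, (τ p + y p)}) ⟨_, P, hP, he, rfl⟩
    exact ⟨Q, hQ, heQ, by beta_reduce; exact_mod_cast h⟩

variable [Fintype E]

/-- The cut over time given by a feasible integral cut meets every temporal path with waiting. -/
theorem IsWeightedCut.exists_mem_cutOverTime {y : E → ℕ}
    (hy : N.IsWeightedCut τ T (fun e => (y e : ℝ))) {S : Finset (E × ℕ)}
    (hS : S ∈ N.waitingPaths τ T) : ∃ a ∈ S, a ∈ N.cutOverTime τ T y := by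
  obtain ⟨-, P, hP, σ, -, hσ, rfl⟩ := Finset.mem_filter.1 hS
  obtain ⟨e, he, h1, h2⟩ := hy.exists_blocking (N.isEntryDistance_cutEntry τ y) hP
    (θ := fun e => (N.entryTime τ P σ e : ℝ)) (fun e _ => Nat.cast_nonneg _)
    (fun e he f hf hef => by exact_mod_cast entryTime_add_le_entryTime hP σ he hf hef)
    (fun e he => by exact_mod_cast (entryTime_add_le hP σ he).trans_lt hσ)
  have hT : N.entryTime τ P σ e < T :=
    (Nat.le_add_right _ _).trans_lt ((entryTime_add_le hP σ he).trans_lt hσ)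
  have hmem : (e, N.entryTime τ P σ e) ∈ timedElements (E := E) T := by
    simpa [timedElements] using hT
  refine ⟨(e, N.entryTime τ P σ e), Finset.mem_filter.2 ⟨hmem, he, rfl⟩,
    Finset.mem_filter.2 ⟨hmem, by exact_mod_cast h1, by exact_mod_cast h2⟩⟩

/-- Each `e` is blocked at no more than `y e` integer times; restricting to the horizon can only
drop some. -/
theorem sum_cutOverTime_le {c : E → ℝ} (hc : ∀ e, 0 ≤ c e) (y : E → ℕ) :
    ∑ a ∈ N.cutOverTime τ T y, c a.1 ≤ ∑ e, c e * (y e : ℝ) := by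
  have hsub : N.cutOverTime τ T y ⊆ (Finset.univ.sigma fun e =>
      Finset.Ico (N.cutEntry τ y e) (N.cutEntry τ y e + y e)).map
        (Equiv.sigmaEquivProd E ℕ).toEmbedding := by
    intro a ha
    have := (Finset.mem_filter.1 ha).2
    simp only [Finset.mem_map_equiv, Finset.mem_sigma, Finset.mem_univ, Finset.mem_Ico, true_and]
    exact this
  refine (Finset.sum_le_sum_of_subset_of_nonneg hsub fun a _ _ => hc a.1).trans (le_of_eq ?_)
  rw [Finset.sum_map, Finset.sum_sigma]
  refine Finset.sum_congr rfl fun e _ => ?_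
  simp [mul_comm]

/-- The value of a flow over time with waiting is at most the cost of an integral cut. -/
theorem IsWaitingFlow.sum_le_cost {c : E → ℝ} (hc : ∀ e, 0 ≤ c e) {x : Finset (E × ℕ) → ℝ}
    (hx : N.IsWaitingFlow c τ T x) {y : E → ℕ} (hy : N.IsWeightedCut τ T (fun e => (y e : ℝ))) :
    ∑ S ∈ N.waitingPaths τ T, x S ≤ ∑ e, c e * (y e : ℝ) := by
  refine le_trans ?_ (sum_cutOverTime_le (N := N) (τ := τ) (T := T) hc y)
  -- Weak duality in the time expansion, with the indicator of the cut over time as covering and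
  -- unit weights.
  have h := Finset.sum_mul_le_sum_mul_of_covering (U := timedElements T) (c := fun a => c a.1)
    (y := fun a => if a ∈ N.cutOverTime τ T y then 1 else 0) (r := fun _ => 1)
    (fun S hS => Finset.mem_powerset.1 (Finset.mem_filter.1 hS).1) hx.1 hx.2
    (fun a _ => by split_ifs <;> norm_num) (fun S hS => ?_)
  · simp only [one_mul, mul_ite, mul_one, mul_zero, Finset.sum_ite_mem] at h
    rwa [Finset.inter_eq_right.2 (show N.cutOverTime τ T y ⊆ timedElements T from
      Finset.filter_subset _ _)] at h
  · obtain ⟨a, ha, haC⟩ := hy.exists_mem_cutOverTime hS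
    have := Finset.single_le_sum
      (f := fun a => if a ∈ N.cutOverTime τ T y then (1 : ℝ) else 0)
      (fun a _ => by split_ifs <;> norm_num) ha
    simpa [haC] using this

theorem mem_temporalPath {P : Finset E} {t : ℕ} (ht : t + ∑ p ∈ P, τ p < T) {a : E × ℕ} :
    a ∈ N.temporalPath τ T P t ↔ a.1 ∈ P ∧ a.2 = t + ∑ p ∈ N.before P a.1, τ p := by
  have := Finset.sum_le_sum_of_subset (f := τ) (N.before_subset P a.1)
  simp only [temporalPath, timedElements, Finset.mem_filter, Finset.mem_product, Finset.mem_univ,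
    Finset.mem_range, true_and, and_iff_right_iff_imp]
  rintro ⟨-, h⟩
  omega

theorem image_fst_temporalPath {P : Finset E} {t : ℕ} (ht : t + ∑ p ∈ P, τ p < T) :
    (N.temporalPath τ T P t).image Prod.fst = P := by
  ext e
  simp [mem_temporalPath ht]

theorem eq_of_mem_temporalPath {P : Finset E} {t t' : ℕ} (ht : t + ∑ p ∈ P, τ p < T)
    (ht' : t' + ∑ p ∈ P, τ p < T) {a : E × ℕ} (ha : a ∈ N.temporalPath τ T P t)
    (ha' : a ∈ N.temporalPath τ T P t') : t = t' := by
  have h1 := ((mem_temporalPath ht).1 ha).2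
  have h2 := ((mem_temporalPath ht').1 ha').2
  omega

/-- Sums over the temporal paths, parametrized by the path and the starting time. -/
theorem sum_temporalPaths (f : Finset (E × ℕ) → ℝ) :
    ∑ S ∈ N.temporalPaths τ T, f S =
      ∑ P ∈ N.paths, ∑ t ∈ Finset.range (T - ∑ p ∈ P, τ p), f (N.temporalPath τ T P t) := by
  have himage : N.temporalPaths τ T = (N.paths.sigma fun P => Finset.range (T - ∑ p ∈ P, τ p)).image
      fun i => N.temporalPath τ T i.1 i.2 := by
    ext S
    simp only [temporalPaths, Finset.mem_filter, Finset.mem_powerset, Finset.mem_image,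
      Finset.mem_sigma, Finset.mem_range, Sigma.exists]
    constructor
    · rintro ⟨-, P, hP, t, -, ht, rfl⟩
      exact ⟨P, t, ⟨hP, by omega⟩, rfl⟩
    · rintro ⟨P, t, ⟨hP, ht⟩, rfl⟩
      exact ⟨Finset.filter_subset _ _, P, hP, t, by omega, by omega, rfl⟩
  rw [himage, Finset.sum_image, Finset.sum_sigma]
  rintro ⟨P, t⟩ h ⟨P', t'⟩ h' heq
  simp only [Finset.coe_sigma, Set.mem_sigma_iff, Finset.mem_coe, Finset.mem_range] at h h' heq
  have ht : t + ∑ p ∈ P, τ p < T := by omega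
  have ht' : t' + ∑ p ∈ P', τ p < T := by omega
  obtain rfl : P = P' := by
    rw [← image_fst_temporalPath (N := N) ht, heq, image_fst_temporalPath ht']
  obtain ⟨e, he⟩ := N.nonempty P h.1
  have hmem : (e, t + ∑ p ∈ N.before P e, τ p) ∈ N.temporalPath τ T P t :=
    (mem_temporalPath ht).2 ⟨he, rfl⟩
  rw [eq_of_mem_temporalPath ht ht' hmem (heq ▸ hmem)]

/-- A temporal path that starts at time `t` waits at its first element only. -/
theorem temporalPaths_subset_waitingPaths : N.temporalPaths τ T ⊆ N.waitingPaths τ T := by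
  intro S hS
  obtain ⟨hsub, P, hP, t, htT, ht, rfl⟩ := Finset.mem_filter.1 hS
  obtain ⟨m, hm, hfirst⟩ := exists_first hP (N.nonempty P hP) (Finset.Subset.refl P)
  have hentry : ∀ e ∈ P, N.entryTime τ P (Pi.single m t) e = t + ∑ p ∈ N.before P e, τ p := by
    intro e he
    rw [entryTime, Finset.sum_add_distrib, Finset.sum_pi_single']
    rcases N.lt_total P hP m hm e he with h | rfl | h
    · have hme : e ≠ m := by
        rintro rfl
        exact N.lt_irrefl P hP e he h
      simp [N.mem_before, hm, h, hme]
    · simp [N.mem_before, N.lt_irrefl P hP m hm, add_comm]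
    · exact absurd h (hfirst e he)
  refine Finset.mem_filter.2 ⟨hsub, P, hP, Pi.single m t, fun e _ => ?_, ?_, ?_⟩
  · simp only [Pi.single_apply]
    split_ifs <;> omega
  · rw [Finset.sum_add_distrib, Finset.sum_pi_single', if_pos hm]
    exact ht
  · refine Finset.filter_congr fun a _ => ?_
    refine and_congr_right fun ha => ?_
    rw [hentry a.1 ha]

/-- The predicate is kept general to serve both the load of one temporal element and the total
value. -/
theorem sum_temporallyRepeated (x : Finset E → ℝ) (p : Finset (E × ℕ) → Prop)
    [DecidablePred p] :
    ∑ S ∈ (N.waitingPaths τ T).filter p, N.temporallyRepeated τ T x S =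
      ∑ P ∈ N.paths, ∑ t ∈ Finset.range (T - ∑ p ∈ P, τ p),
        if p (N.temporalPath τ T P t) then x P else 0 := by
  rw [Finset.sum_filter, ← Finset.sum_subset temporalPaths_subset_waitingPaths, sum_temporalPaths]
  · refine Finset.sum_congr rfl fun P hP => Finset.sum_congr rfl fun t ht => ?_
    have ht : t + ∑ p ∈ P, τ p < T := by
      rw [Finset.mem_range] at ht
      omega
    have hmem : N.temporalPath τ T P t ∈ N.temporalPaths τ T :=
      Finset.mem_filter.2 ⟨Finset.mem_powerset.2 (Finset.filter_subset _ _), P, hP, t, by omega, ht,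
        rfl⟩
    rw [temporallyRepeated, if_pos hmem, image_fst_temporalPath ht]
  · intro S _ hS
    simp [temporallyRepeated, hS]

/-- For each `P`, at most one starting time leads through a given `(e, θ)`, so the load there is at
most the static load of `e`. -/
theorem IsFlow.isWaitingFlow_temporallyRepeated {c : E → ℝ} {x : Finset E → ℝ}
    (hx : N.IsFlow c x) : N.IsWaitingFlow c τ T (N.temporallyRepeated τ T x) := by
  refine ⟨fun S _ => ?_, fun a _ => ?_⟩
  · rw [temporallyRepeated]
    split_ifs with hS
    · obtain ⟨-, P, hP, t, -, ht, rfl⟩ := Finset.mem_filter.1 hS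
      rw [image_fst_temporalPath ht]
      exact hx.1 P hP
    · exact le_rfl
  · rw [sum_temporallyRepeated]
    refine le_trans ?_ (hx.2 a.1)
    rw [Finset.sum_filter]
    refine Finset.sum_le_sum fun P hP => ?_
    have hlt : ∀ t ∈ Finset.range (T - ∑ p ∈ P, τ p), t + ∑ p ∈ P, τ p < T := fun t ht => by
      rw [Finset.mem_range] at ht
      omega
    split_ifs with ha
    · rw [← Finset.sum_filter, Finset.sum_const, nsmul_eq_mul]
      refine mul_le_of_le_one_left (hx.1 P hP) ?_
      rw [Nat.cast_le_one, Finset.card_le_one]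
      intro t ht t' ht'
      rw [Finset.mem_filter] at ht ht'
      exact eq_of_mem_temporalPath (hlt t ht.1) (hlt t' ht'.1) ht.2 ht'.2
    · refine (Finset.sum_eq_zero fun t ht => if_neg fun h => ha ?_).le
      exact ((mem_temporalPath (hlt t ht)).1 h).1

/-- The temporally repeated flow of an optimal static flow has the same value. -/
theorem IsMaxWeightedFlow.sum_temporallyRepeated {c : E → ℝ} {x : Finset E → ℝ}
    (hx : N.IsMaxWeightedFlow c τ T x) :
    ∑ S ∈ N.waitingPaths τ T, N.temporallyRepeated τ T x S =
      ∑ P ∈ N.paths, weight τ T P * x P := by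
  have h := AbstractNetwork.sum_temporallyRepeated (N := N) (τ := τ) (T := T) x fun _ => True
  simp only [Finset.filter_true, if_true, Finset.sum_const, Finset.card_range, nsmul_eq_mul] at h
  rw [h]
  refine Finset.sum_congr rfl fun P hP => ?_
  -- The number of starting times is the truncated difference. It differs from the weight only when
  -- the weight is negative, where an optimal `x` vanishes.
  rcases le_or_gt (∑ p ∈ P, τ p) T with hle | hlt
  · rw [weight, Nat.cast_sub hle, Nat.cast_sum]
  · rw [hx.eq_zero_of_weight_neg hP ?_, mul_zero, mul_zero]
    rw [weight, sub_neg]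
    exact_mod_cast hlt

end OverTime

end AbstractNetwork

theorem mainTheorem2 {E : Type*} [Fintype E] (N : AbstractNetwork E)
    (c : E → ℝ) (hc : ∀ e, 0 ≤ c e) (τ : E → ℕ) (T : ℕ) :
    (∃ x : Finset (E × ℕ) → ℝ, N.IsMaxWaitingFlow c τ T x ∧ N.DoesNotWait τ T x) ∧
    (∃ x : Finset E → ℝ, N.IsMaxWeightedFlow c τ T x) ∧
    (∀ x : Finset E → ℝ, N.IsMaxWeightedFlow c τ T x →
      N.IsMaxWaitingFlow c τ T (N.temporallyRepeated τ T x)) ∧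
    (∃ y : E → ℕ, N.IsMinWeightedCut c τ T (fun e => (y e : ℝ))) ∧
    (∀ y : E → ℕ, N.IsMinWeightedCut c τ T (fun e => (y e : ℝ)) →
      ∀ S ∈ N.waitingPaths τ T, ∃ a ∈ S, a ∈ N.cutOverTime τ T y) := by
  obtain ⟨x, hx, z, hz, hle⟩ := N.exists_flow_natCut_cost_le hc τ T
  have hmax : N.IsMaxWeightedFlow c τ T x := ⟨hx, fun x' hx' => (hx'.weight_le_cost hz).trans hle⟩
  have hrep : ∀ x : Finset E → ℝ, N.IsMaxWeightedFlow c τ T x →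
      N.IsMaxWaitingFlow c τ T (N.temporallyRepeated τ T x) := fun x' hx' =>
    ⟨hx'.1.isWaitingFlow_temporallyRepeated, fun f hf => by
      rw [hx'.sum_temporallyRepeated]
      exact ((hf.sum_le_cost hc hz).trans hle).trans (hx'.2 x hx)⟩
  exact ⟨⟨_, hrep x hmax, fun S _ hS => if_neg hS⟩, ⟨x, hmax⟩, hrep,
    ⟨z, hz, fun y' hy' => hle.trans (hx.weight_le_cost hy')⟩,
    fun y hy S hS => hy.1.exists_mem_cutOverTime hS⟩
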